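/- Let $R$ be a ring with unit (not necessarily commutative), and let $i$ be a length function on the category of left $R$-modules. This means that $i$ assigns to every left $R$-module a value in $\mathbb R_{\ge 0}\cup\{\infty\}$ such that $i(0)=0$, isomorphic modules have the same value, $i(M)=i(N)+i(M/N)$ for every submodule $N\subseteq M$ (additivity), and $i(M)=\sup\{i(F): F\subseteq M \text{ a finitely generated submodule}\}$ (upper continuity). Let $M$ be a left $R$-module that is locally $i$-finite, i.e. $i(Rx)<\infty$ for every $x\in M$, and let $\phi$ be an endomorphism of $M$. For an $R$-module $N$ and an endomorphism $\psi$ of $N$, put $$T_n(\psi,F)=F+\psi(F)+\dots+\psi^{n-1}(F),\qquad \mathrm{ent}_i(\psi)=\sup\Big\{\lim_{n\to\infty}\frac{i(T_n(\psi,F))}{n} : F\subseteq N \text{ a submodule with } i(F)<\infty\Big\},$$ where the limits exist. Let $\mathbf P_{\mathrm{ent}_i}(M,\phi)$ (the Pinsker submodule) be the sum of all $\phi$-invariant submodules $N\subseteq M$ with $\mathrm{ent}_i(\phi|_N)=0$, and let $$\mathfrak A(M,\phi)=\Big\{x\in M: \exists k\in\mathbb N,\ a_0,\dots,a_{k-1}\in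 R,\ \phi^k(x)=\sum_{j=0}^{k-1}a_j\phi^j(x)\Big\},$$ $$\mathfrak W(M,\phi)=\Big\{x\in M: \exists\, p\in R[t]\setminus\{0\},\ p(\phi)(x)=0\Big\},$$ where $p(\phi)(x)=\sum_j a_j\phi^j(x)$ for $p=\sum_j a_jt^j$. Then $\mathfrak A(M,\phi)\subseteq \mathbf P_{\mathrm{ent}_i}(M,\phi)$. If moreover $R$ is an integral domain (commutativity is not required) and $i$ is not identically $0$, then $\mathbf P_{\mathrm{ent}_i}(M,\phi)\subseteq\mathfrak W(M,\phi)$. -/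

import Mathlib

open scoped ENNReal Polynomial

universe u v

namespace AlgFlow

section Definitions

variable {R : Type u} [Ring R]

/-- A length function on the category of left `R`-modules: an invariant with values in
`[0, ∞]` which is additive and upper continuous. -/
structure IsLengthFunction (i : ModuleCat.{v} R → ℝ≥0∞) : Prop where
  zero : i (ModuleCat.of R PUnit.{v + 1}) = 0
  iso : ∀ M N : ModuleCat.{v} R, Nonempty (M ≃ₗ[R] N) → i M = i N
  additive : ∀ (M : ModuleCat.{v} R) (N : Submodule R M),
    i M = i (ModuleCat.of R N) + i (ModuleCat.of R (M ⧸ N))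
  upperContinuous : ∀ M : ModuleCat.{v} R,
    i M = ⨆ (F : Submodule R M) (_ : F.FG), i (ModuleCat.of R F)

variable {M : Type v} [AddCommGroup M] [Module R M]

/-- The `n`-th trajectory `T_n(φ, F) = F + φ(F) + ⋯ + φ^(n-1)(F)`. -/
def trajectory (φ : Module.End R M) (n : ℕ) (F : Submodule R M) : Submodule R M :=
  ⨆ j ∈ Finset.range n, F.map (φ ^ j)

/-- The entropy `H_i(φ, F) = lim i(T_n(φ, F)) / n` of `φ` with respect to `F`. It is used only
for `i F < ∞` and `i` additive; the sequence then converges (`tendsto_entropyWith` below), so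
that the upper limit is the limit. -/
noncomputable def entropyWith (i : ModuleCat.{v} R → ℝ≥0∞) (φ : Module.End R M)
    (F : Submodule R M) : ℝ≥0∞ :=
  Filter.limsup (fun n : ℕ => i (ModuleCat.of R (trajectory φ n F)) / (n : ℝ≥0∞)) Filter.atTop

/-- The `i`-entropy `ent_i(φ)`: the supremum of `H_i(φ, F)` over the submodules `F` with
`i F < ∞`. -/
noncomputable def ent (i : ModuleCat.{v} R → ℝ≥0∞) (φ : Module.End R M) : ℝ≥0∞ :=
  ⨆ (F : Submodule R M) (_ : i (ModuleCat.of R F) < ∞), entropyWith i φ F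

/-- `M` is locally `i`-finite: every cyclic submodule `Rx` has `i(Rx) < ∞`. -/
def LocallyFinite (i : ModuleCat.{v} R → ℝ≥0∞) (M : Type v) [AddCommGroup M] [Module R M] :
    Prop :=
  ∀ x : M, i (ModuleCat.of R (Submodule.span R {x})) < ∞

/-- The Pinsker submodule of the flow `(M, φ)` with respect to `ent_i`: the sum of all
`φ`-invariant submodules `N` (the subobjects of the flow) with `ent_i(φ|_N) = 0`. -/
noncomputable def pinsker (i : ModuleCat.{v} R → ℝ≥0∞) (φ : Module.End R M) : Submodule R M :=
  sSup {N : Submodule R M | ∃ hN : ∀ x ∈ N, φ x ∈ N, ent i (φ.restrict hN) = 0}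

/-- The pointwise-integral part `𝔄(M, φ)`. -/
def integralPart (φ : Module.End R M) : Set M :=
  {x | ∃ (k : ℕ) (a : Fin k → R), (φ ^ k) x = ∑ j : Fin k, a j • (φ ^ (j : ℕ)) x}

/-- The pointwise-algebraic part `𝔚(M, φ)`: the `x` with `p(φ)(x) = 0` for some nonzero
polynomial `p`, where `p(φ)(x) = ∑ a_j φ^j(x)` for `p = ∑ a_j t^j`. -/
def algebraicPart (φ : Module.End R M) : Set M :=
  {x | ∃ p : R[X], p ≠ 0 ∧ p.sum (fun j a => a • (φ ^ j) x) = 0}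

end Definitions

section Convergence

variable {R : Type u} [Ring R] {i : ModuleCat.{v} R → ℝ≥0∞}
  {M : Type v} [AddCommGroup M] [Module R M]

theorem IsLengthFunction.le_of_injective (hi : IsLengthFunction i) {A B : Type v}
    [AddCommGroup A] [Module R A] [AddCommGroup B] [Module R B] (f : A →ₗ[R] B)
    (hf : Function.Injective f) : i (ModuleCat.of R A) ≤ i (ModuleCat.of R B) := by
  rw [hi.additive (ModuleCat.of R B) (LinearMap.range f),
    hi.iso (ModuleCat.of R A) (ModuleCat.of R (LinearMap.range f))
      ⟨LinearEquiv.ofInjective f hf⟩]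
  exact le_self_add

theorem IsLengthFunction.le_of_surjective (hi : IsLengthFunction i) {A B : Type v}
    [AddCommGroup A] [Module R A] [AddCommGroup B] [Module R B] (f : A →ₗ[R] B)
    (hf : Function.Surjective f) : i (ModuleCat.of R B) ≤ i (ModuleCat.of R A) := by
  rw [hi.additive (ModuleCat.of R A) (LinearMap.ker f),
    hi.iso (ModuleCat.of R B) (ModuleCat.of R (A ⧸ LinearMap.ker f))
      ⟨(f.quotKerEquivOfSurjective hf).symm⟩]
  exact le_add_self

theorem IsLengthFunction.map_le (hi : IsLengthFunction i) (f : Module.End R M)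
    (F : Submodule R M) : i (ModuleCat.of R (F.map f)) ≤ i (ModuleCat.of R F) :=
  hi.le_of_surjective (f.submoduleMap F) (f.submoduleMap_surjective F)

theorem IsLengthFunction.mono (hi : IsLengthFunction i) {A B : Submodule R M} (h : A ≤ B) :
    i (ModuleCat.of R A) ≤ i (ModuleCat.of R B) :=
  hi.le_of_injective (Submodule.inclusion h) (Submodule.inclusion_injective h)

theorem IsLengthFunction.sup_le (hi : IsLengthFunction i) (A B : Submodule R M) :
    i (ModuleCat.of R ↥(A ⊔ B)) ≤ i (ModuleCat.of R A) + i (ModuleCat.of R B) := by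
  have h : i (ModuleCat.of R ↥(A ⊔ B)) ≤ i (ModuleCat.of R (A × B)) :=
    hi.le_of_surjective
      ((Submodule.inclusion le_sup_left).coprod (Submodule.inclusion le_sup_right)) (by
        rintro ⟨x, hx⟩
        obtain ⟨a, ha, b, hb, rfl⟩ := Submodule.mem_sup.1 hx
        exact ⟨(⟨a, ha⟩, ⟨b, hb⟩), rfl⟩)
  refine h.trans ?_
  rw [hi.additive (ModuleCat.of R (A × B)) (LinearMap.range (LinearMap.inl R A B))]
  refine add_le_add ?_ ?_
  · exact hi.le_of_surjective (LinearMap.inl R A B).rangeRestrict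
      (LinearMap.surjective_rangeRestrict _)
  · have hr : LinearMap.range (LinearMap.inl R A B) = LinearMap.ker (LinearMap.snd R A B) :=
      LinearMap.range_inl R A B
    rw [hr]
    exact hi.le_of_injective ((LinearMap.snd R A B).ker.liftQ (LinearMap.snd R A B) le_rfl)
      (LinearMap.ker_eq_bot.1 (Submodule.ker_liftQ_eq_bot _ _ _ le_rfl))

theorem trajectory_zero (φ : Module.End R M) (F : Submodule R M) : trajectory φ 0 F = ⊥ := by
  simp [trajectory]

theorem trajectory_succ (φ : Module.End R M) (n : ℕ) (F : Submodule R M) :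
    trajectory φ (n + 1) F = trajectory φ n F ⊔ F.map (φ ^ n) := by
  simp only [trajectory, Finset.range_add_one, Finset.iSup_insert]
  exact sup_comm _ _

theorem trajectory_add (φ : Module.End R M) (m n : ℕ) (F : Submodule R M) :
    trajectory φ (m + n) F = trajectory φ m F ⊔ (trajectory φ n F).map (φ ^ m) := by
  induction n with
  | zero => simp [trajectory_zero]
  | succ n ih =>
    rw [← add_assoc, trajectory_succ, ih, trajectory_succ, Submodule.map_sup,
      ← Submodule.map_comp, ← Module.End.mul_eq_comp, ← pow_add, sup_assoc]

theorem IsLengthFunction.bot (hi : IsLengthFunction i) :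
    i (ModuleCat.of R (⊥ : Submodule R M)) = 0 :=
  (hi.iso _ (ModuleCat.of R PUnit.{v + 1})
    ⟨⟨0, fun _ => 0, fun _ => Subsingleton.elim _ _, fun _ => Subsingleton.elim _ _⟩⟩).trans
    hi.zero

theorem IsLengthFunction.trajectory_lt_top (hi : IsLengthFunction i) (φ : Module.End R M)
    {F : Submodule R M} (hF : i (ModuleCat.of R F) < ∞) (n : ℕ) :
    i (ModuleCat.of R (trajectory φ n F)) < ∞ := by
  induction n with
  | zero => rw [trajectory_zero, hi.bot]; exact ENNReal.zero_lt_top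
  | succ n ih =>
    rw [trajectory_succ]
    exact (hi.sup_le _ _).trans_lt
      (ENNReal.add_lt_top.2 ⟨ih, (hi.map_le _ _).trans_lt hF⟩)

/-- For `i F < ∞` the limit that defines `H_i(φ, F)` exists. -/
theorem tendsto_entropyWith (hi : IsLengthFunction i) (φ : Module.End R M)
    {F : Submodule R M} (hF : i (ModuleCat.of R F) < ∞) :
    Filter.Tendsto (fun n : ℕ => i (ModuleCat.of R (trajectory φ n F)) / (n : ℝ≥0∞))
      Filter.atTop (nhds (entropyWith i φ F)) := by
  have hfin := hi.trajectory_lt_top φ hF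
  have hsub : Subadditive fun n : ℕ => (i (ModuleCat.of R (trajectory φ n F))).toReal := by
    intro m n
    rw [← ENNReal.toReal_add (hfin m).ne (hfin n).ne]
    refine ENNReal.toReal_mono (ENNReal.add_lt_top.2 ⟨hfin m, hfin n⟩).ne ?_
    rw [trajectory_add]
    exact (hi.sup_le _ _).trans (add_le_add le_rfl (hi.map_le _ _))
  have hlim := ENNReal.tendsto_ofReal (hsub.tendsto_lim ⟨0, by
    rintro _ ⟨n, rfl⟩
    positivity⟩)
  have heq : (fun n : ℕ => ENNReal.ofReal
        ((i (ModuleCat.of R (trajectory φ n F))).toReal / (n : ℝ))) =ᶠ[Filter.atTop]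
      fun n : ℕ => i (ModuleCat.of R (trajectory φ n F)) / (n : ℝ≥0∞) := by
    filter_upwards [Filter.eventually_gt_atTop 0] with n hn
    rw [ENNReal.ofReal_div_of_pos (by exact_mod_cast hn), ENNReal.ofReal_toReal (hfin n).ne,
      ENNReal.ofReal_natCast]
  have h := hlim.congr' heq
  rw [entropyWith, h.limsup_eq]
  exact h

end Convergence

end AlgFlow

namespace AlgFlow

variable {R : Type u} [Ring R] {i : ModuleCat.{v} R → ℝ≥0∞}
  {M : Type v} [AddCommGroup M] [Module R M]

/-! If `x` is integral with a relation of degree `k`, then `x, φ x, …, φ^(k-1) x` span an invariant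
finitely generated `N`. Local finiteness gives `i N < ∞`, so `i(T_n)/n ≤ i(N)/n → 0` and `φ|_N` has
zero entropy.

For the second inclusion, the `x` with `H_i(φ, Rx) = 0` form a submodule containing the Pinsker
submodule (`pinsker_le_zeroEntropySubmodule`). If `x` is not algebraic, `φ^n x` has zero annihilator
modulo `T_n(φ, Rx)`, so each quotient `T_{n+1}/T_n` contains a copy of `R`. Hence `i(T_n) ≥ n ·
i(Ry)` for every cyclic module `Ry` (`nsmul_le_trajectory_of_notMem_algebraicPart`), and some
`i(Ry)` is positive when `i ≠ 0`, so `H_i(φ, Rx) > 0`. -/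

/-! ### Entropy under restriction and sums -/

theorem trajectory_mono (φ : Module.End R M) (n : ℕ) {A B : Submodule R M} (h : A ≤ B) :
    trajectory φ n A ≤ trajectory φ n B :=
  iSup₂_mono fun _ _ => Submodule.map_mono h

theorem trajectory_sup (φ : Module.End R M) (n : ℕ) (A B : Submodule R M) :
    trajectory φ n (A ⊔ B) = trajectory φ n A ⊔ trajectory φ n B := by
  simp only [trajectory, Submodule.map_sup, iSup_sup_eq]

theorem map_subtype_trajectory_restrict {φ : Module.End R M} {N : Submodule R M}
    (hN : ∀ x ∈ N, φ x ∈ N) (n : ℕ) (F : Submodule R N) :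
    (trajectory (φ.restrict hN) n F).map N.subtype = trajectory φ n (F.map N.subtype) := by
  have hcomp (j : ℕ) : N.subtype ∘ₗ (φ.restrict hN) ^ j = (φ ^ j) ∘ₗ N.subtype := by
    induction j with
    | zero => rfl
    | succ j ih =>
      ext x
      have := LinearMap.congr_fun ih (φ.restrict hN x)
      simpa [pow_succ] using this
  simp only [trajectory, Submodule.map_iSup, ← Submodule.map_comp, hcomp]

theorem IsLengthFunction.map_subtype (hi : IsLengthFunction i) {N : Submodule R M}
    (F : Submodule R N) :
    i (ModuleCat.of R (F.map N.subtype)) = i (ModuleCat.of R F) :=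
  hi.iso _ _ ⟨(Submodule.equivMapOfInjective N.subtype N.injective_subtype F).symm⟩

theorem entropyWith_restrict (hi : IsLengthFunction i) {φ : Module.End R M} {N : Submodule R M}
    (hN : ∀ x ∈ N, φ x ∈ N) (F : Submodule R N) :
    entropyWith i (φ.restrict hN) F = entropyWith i φ (F.map N.subtype) := by
  have h (n : ℕ) : i (ModuleCat.of R (trajectory (φ.restrict hN) n F)) =
      i (ModuleCat.of R (trajectory φ n (F.map N.subtype))) := by
    rw [← map_subtype_trajectory_restrict hN, hi.map_subtype]
  simp only [entropyWith, h]

theorem entropyWith_mono (hi : IsLengthFunction i) (φ : Module.End R M) {A B : Submodule R M}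
    (h : A ≤ B) : entropyWith i φ A ≤ entropyWith i φ B :=
  Filter.limsup_le_limsup (Filter.Eventually.of_forall fun n =>
    ENNReal.div_le_div_right (hi.mono (trajectory_mono φ n h)) _)

/-- Trajectories commute with sums and `i` is subadditive; finiteness makes all three entropies
genuine limits, so the termwise bound passes to them. -/
theorem entropyWith_sup_le (hi : IsLengthFunction i) (φ : Module.End R M)
    {A B : Submodule R M} (hA : i (ModuleCat.of R A) < ∞) (hB : i (ModuleCat.of R B) < ∞) :
    entropyWith i φ (A ⊔ B) ≤ entropyWith i φ A + entropyWith i φ B := by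
  refine le_of_tendsto_of_tendsto'
    (tendsto_entropyWith hi φ ((hi.sup_le A B).trans_lt (ENNReal.add_lt_top.2 ⟨hA, hB⟩)))
    ((tendsto_entropyWith hi φ hA).add (tendsto_entropyWith hi φ hB)) fun n => ?_
  rw [trajectory_sup, ← ENNReal.add_div]
  exact ENNReal.div_le_div_right (hi.sup_le _ _) _

theorem entropyWith_bot (hi : IsLengthFunction i) (φ : Module.End R M) :
    entropyWith i φ ⊥ = 0 := by
  have h (n : ℕ) : trajectory φ n (⊥ : Submodule R M) = ⊥ :=
    le_bot_iff.1 (iSup₂_le fun j _ => (Submodule.map_bot _).le)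
  have h0 (n : ℕ) : i (ModuleCat.of R (trajectory φ n (⊥ : Submodule R M))) = 0 := by
    rw [h, hi.bot]
  simp [entropyWith, h0]

/-- The elements that generate a cyclic submodule of zero entropy form a submodule. -/
def zeroEntropySubmodule (hi : IsLengthFunction i) (φ : Module.End R M)
    (hM : LocallyFinite i M) : Submodule R M where
  carrier := {x | entropyWith i φ (Submodule.span R {x}) = 0}
  zero_mem' := by
    change entropyWith i φ _ = 0
    rw [Submodule.span_zero_singleton, entropyWith_bot hi]
  add_mem' := by
    intro x y hx hy
    have hle : Submodule.span R {x + y} ≤ Submodule.span R {x} ⊔ Submodule.span R {y} :=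
      (Submodule.span_singleton_le_iff_mem _ _).2
        (Submodule.add_mem_sup (Submodule.mem_span_singleton_self x)
          (Submodule.mem_span_singleton_self y))
    refine le_antisymm ?_ zero_le
    calc _ ≤ _ := entropyWith_mono hi φ hle
      _ ≤ _ := entropyWith_sup_le hi φ (hM x) (hM y)
      _ = 0 := by rw [hx, hy, add_zero]
  smul_mem' := by
    intro r x hx
    refine le_antisymm ((entropyWith_mono hi φ ?_).trans_eq hx) zero_le
    exact (Submodule.span_singleton_le_iff_mem _ _).2
      (Submodule.smul_mem _ r (Submodule.mem_span_singleton_self x))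

/-- The target is closed under sums, so each summand `N` can be treated alone: there `H_i(φ, Rx)`
may be computed inside `N`, where it is bounded by `ent i (φ|_N) = 0`. -/
theorem pinsker_le_zeroEntropySubmodule (hi : IsLengthFunction i) (φ : Module.End R M)
    (hM : LocallyFinite i M) : pinsker i φ ≤ zeroEntropySubmodule hi φ hM := by
  refine sSup_le ?_
  rintro N ⟨hN, hent⟩ x hx
  have hmap : (Submodule.span R {(⟨x, hx⟩ : N)}).map N.subtype = Submodule.span R {x} := by
    rw [Submodule.map_span, Set.image_singleton, Submodule.subtype_apply]
  have hfin : i (ModuleCat.of R (Submodule.span R {(⟨x, hx⟩ : N)})) < ∞ := by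
    rw [← hi.map_subtype, hmap]
    exact hM x
  change entropyWith i φ (Submodule.span R {x}) = 0
  rw [← hmap, ← entropyWith_restrict hi hN]
  refine le_antisymm (le_of_le_of_eq ?_ hent) zero_le
  exact le_iSup₂_of_le (f := fun (F : Submodule R N) (_ : i (ModuleCat.of R F) < ∞) =>
    entropyWith i (φ.restrict hN) F) _ hfin le_rfl

/-! ### Integral elements lie in the Pinsker submodule -/

theorem LocallyFinite.lt_top_of_fg (hi : IsLengthFunction i) (hM : LocallyFinite i M)
    {F : Submodule R M} (hF : F.FG) : i (ModuleCat.of R F) < ∞ :=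
  Submodule.fg_induction (motive := fun F _ => i (ModuleCat.of R F) < ∞) hM
    (fun A B _ _ hA hB => (hi.sup_le A B).trans_lt (ENNReal.add_lt_top.2 ⟨hA, hB⟩)) F hF

theorem ent_eq_zero_of_lt_top (hi : IsLengthFunction i) (φ : Module.End R M)
    (hM : i (ModuleCat.of R M) < ∞) : ent i φ = 0 := by
  refine le_antisymm (iSup₂_le fun F hF => ?_) zero_le
  have hle : entropyWith i φ F ≤
      Filter.limsup (fun n : ℕ => i (ModuleCat.of R M) / (n : ℝ≥0∞)) Filter.atTop :=
    Filter.limsup_le_limsup (Filter.Eventually.of_forall fun n =>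
      ENNReal.div_le_div_right
        (hi.le_of_injective (trajectory φ n F).subtype (Submodule.injective_subtype _)) _)
  refine hle.trans_eq (Filter.Tendsto.limsup_eq ?_)
  have := ENNReal.Tendsto.const_div (a := i (ModuleCat.of R M)) ENNReal.tendsto_nat_nhds_top
    (Or.inr hM.ne)
  simpa using this

theorem integralPart_subset_pinsker (hi : IsLengthFunction i) (φ : Module.End R M)
    (hM : LocallyFinite i M) : integralPart φ ⊆ (pinsker i φ : Set M) := by
  rintro x ⟨k, a, hx⟩
  set N : Submodule R M := Submodule.span R (Set.range fun j : Fin k => (φ ^ (j : ℕ)) x)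
    with hNdef
  have hmem (j : ℕ) (hj : j < k) : (φ ^ j) x ∈ N := Submodule.subset_span ⟨⟨j, hj⟩, rfl⟩
  have hk : (φ ^ k) x ∈ N := by
    rw [hx]
    exact Submodule.sum_mem _ fun j _ => Submodule.smul_mem _ _ (hmem j j.2)
  have hN : ∀ y ∈ N, φ y ∈ N := by
    change N ≤ N.comap φ
    refine Submodule.span_le.2 ?_
    rintro _ ⟨j, rfl⟩
    change φ ((φ ^ (j : ℕ)) x) ∈ N
    rw [← Module.End.mul_apply, ← pow_succ']
    -- Only the last generator is moved out of the list, to `φ^k x`, which the relation brings back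
    -- into `N`.
    rcases (Nat.succ_le_of_lt j.2).lt_or_eq with h | h
    · exact hmem _ h
    · rw [← Nat.succ_eq_add_one, h]
      exact hk
  have hxN : x ∈ N := by
    -- For `k = 0` there are no generators, but then `hk` itself speaks of `φ^0 x = x`.
    rcases Nat.eq_zero_or_pos k with rfl | h
    · exact hk
    · exact hmem 0 h
  have hfg : N.FG := Submodule.fg_span (Set.finite_range _)
  refine (le_sSup ?_ : N ≤ pinsker i φ) hxN
  exact ⟨hN, ent_eq_zero_of_lt_top hi _ (LocallyFinite.lt_top_of_fg hi hM hfg)⟩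

/-! ### Pinsker elements are algebraic -/

/-- If `i` vanished on all cyclic submodules, subadditivity would extend this to finitely generated
ones and upper continuity to `N`. -/
theorem IsLengthFunction.exists_span_singleton_ne_zero (hi : IsLengthFunction i)
    (N : ModuleCat.{v} R) (hN : i N ≠ 0) :
    ∃ y : N, i (ModuleCat.of R (Submodule.span R {y})) ≠ 0 := by
  by_contra! h
  refine hN ?_
  rw [hi.upperContinuous N]
  refine le_antisymm (iSup₂_le fun F hF => le_of_eq ?_) zero_le
  exact Submodule.fg_induction (motive := fun F _ => i (ModuleCat.of R F) = 0) h
    (fun A B _ _ hA hB => le_antisymm ((hi.sup_le A B).trans_eq (by rw [hA, hB, add_zero])) zero_le)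
    F hF

/-- An element `z` with zero annihilator generates a copy of `R`, which maps onto every cyclic
module. -/
theorem IsLengthFunction.span_singleton_le_of_smul_eq_zero (hi : IsLengthFunction i)
    {N : Type v} [AddCommGroup N] [Module R N] {z : M} (hz : ∀ r : R, r • z = 0 → r = 0)
    (y : N) : i (ModuleCat.of R (Submodule.span R {y})) ≤ i (ModuleCat.of R M) := by
  have hinj : Function.Injective (LinearMap.toSpanSingleton R M z) :=
    (injective_iff_map_eq_zero _).2 hz
  let e := LinearEquiv.ofInjective _ hinj
  rw [← LinearMap.range_toSpanSingleton]
  refine le_trans ?_ (hi.le_of_injective (LinearMap.range (LinearMap.toSpanSingleton R M z)).subtype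
    (Submodule.injective_subtype _))
  exact hi.le_of_surjective ((LinearMap.toSpanSingleton R N y).rangeRestrict ∘ₗ e.symm.toLinearMap)
    ((LinearMap.surjective_rangeRestrict _).comp e.symm.surjective)

/-- The linear map `p ↦ p(φ)(x)`. -/
noncomputable def evalAt (φ : Module.End R M) (x : M) : R[X] →ₗ[R] M :=
  Polynomial.lsum fun j => LinearMap.toSpanSingleton R M ((φ ^ j) x)

theorem evalAt_apply (φ : Module.End R M) (x : M) (p : R[X]) :
    evalAt φ x p = p.sum fun j a => a • (φ ^ j) x := rfl

theorem evalAt_monomial (φ : Module.End R M) (x : M) (n : ℕ) (r : R) :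
    evalAt φ x (Polynomial.monomial n r) = r • (φ ^ n) x := by
  exact Polynomial.sum_monomial_index r (fun j a => a • (φ ^ j) x) (zero_smul R _)

theorem trajectory_span_singleton_le (φ : Module.End R M) (x : M) (n : ℕ) :
    trajectory φ n (Submodule.span R {x}) ≤ (Polynomial.degreeLT R n).map (evalAt φ x) := by
  refine iSup₂_le fun j hj => ?_
  rw [Submodule.map_span, Set.image_singleton, Submodule.span_singleton_le_iff_mem]
  refine Submodule.mem_map.2 ⟨Polynomial.monomial j 1, Polynomial.mem_degreeLT.2 ?_, ?_⟩
  · exact (Polynomial.degree_monomial_le j _).trans_lt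
      (by exact_mod_cast Finset.mem_range.1 hj)
  · rw [evalAt_monomial, one_smul]

/-- Writing the element as `p(φ)(x)` with `deg p < n`, the polynomial `r t^n - p` kills `x`, so it
is zero, and its coefficient at `n` is `r`. -/
theorem smul_pow_apply_notMem_trajectory {φ : Module.End R M} {x : M}
    (hx : x ∉ algebraicPart φ) (n : ℕ) {r : R}
    (hr : r • (φ ^ n) x ∈ trajectory φ n (Submodule.span R {x})) : r = 0 := by
  obtain ⟨p, hp, hpr⟩ := trajectory_span_singleton_le φ x n hr
  have hzero : Polynomial.monomial n r - p = 0 := by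
    by_contra hne
    refine hx ⟨_, hne, ?_⟩
    rw [← evalAt_apply, map_sub, hpr, evalAt_monomial, sub_self]
  have hcoeff : p.coeff n = 0 :=
    Polynomial.coeff_eq_zero_of_degree_lt (Polynomial.mem_degreeLT.1 hp)
  simpa [hcoeff] using congrArg (fun q => Polynomial.coeff q n) hzero

theorem IsLengthFunction.add_quotient_comap_subtype (hi : IsLengthFunction i)
    {A B : Submodule R M} (h : A ≤ B) :
    i (ModuleCat.of R B) =
      i (ModuleCat.of R A) + i (ModuleCat.of R (B ⧸ A.comap B.subtype)) := by
  rw [← hi.iso (ModuleCat.of R (A.comap B.subtype)) (ModuleCat.of R A)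
    ⟨Submodule.comapSubtypeEquivOfLe h⟩]
  exact hi.additive (ModuleCat.of R B) (A.comap B.subtype)

theorem nsmul_le_trajectory_of_notMem_algebraicPart (hi : IsLengthFunction i)
    {φ : Module.End R M} {x : M} (hx : x ∉ algebraicPart φ)
    {N : Type v} [AddCommGroup N] [Module R N] (y : N) (n : ℕ) :
    n * i (ModuleCat.of R (Submodule.span R {y})) ≤
      i (ModuleCat.of R (trajectory φ n (Submodule.span R {x}))) := by
  induction n with
  | zero => simp
  | succ n ih =>
    set F := Submodule.span R {x}
    have hle : trajectory φ n F ≤ trajectory φ (n + 1) F := by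
      rw [trajectory_succ]
      exact le_sup_left
    have hmem : (φ ^ n) x ∈ trajectory φ (n + 1) F := by
      rw [trajectory_succ]
      exact Submodule.mem_sup_right
        (Submodule.mem_map_of_mem (Submodule.mem_span_singleton_self x))
    rw [hi.add_quotient_comap_subtype hle, Nat.cast_succ, add_mul, one_mul]
    -- The class of `φ^n x` in `T_{n+1}/T_n` has zero annihilator, so this quotient contributes at
    -- least `i(Ry)`.
    refine add_le_add ih (hi.span_singleton_le_of_smul_eq_zero
      (z := Submodule.Quotient.mk ⟨(φ ^ n) x, hmem⟩) (fun r hr => ?_) y)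
    rw [← Submodule.Quotient.mk_smul, Submodule.Quotient.mk_eq_zero] at hr
    exact smul_pow_apply_notMem_trajectory hx n hr

theorem le_entropyWith_of_notMem_algebraicPart (hi : IsLengthFunction i)
    {φ : Module.End R M} {x : M} (hx : x ∉ algebraicPart φ)
    {N : Type v} [AddCommGroup N] [Module R N] (y : N) :
    i (ModuleCat.of R (Submodule.span R {y})) ≤ entropyWith i φ (Submodule.span R {x}) := by
  refine Filter.le_limsup_of_frequently_le (Filter.Eventually.frequently ?_)
  filter_upwards [Filter.eventually_gt_atTop 0] with n hn
  rw [ENNReal.le_div_iff_mul_le (Or.inl (by exact_mod_cast hn.ne'))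
    (Or.inl (ENNReal.natCast_ne_top n)), mul_comm]
  exact nsmul_le_trajectory_of_notMem_algebraicPart hi hx y n

theorem pinsker_subset_algebraicPart (hi : IsLengthFunction i) (φ : Module.End R M)
    (hM : LocallyFinite i M) (hne : ∃ N : ModuleCat.{v} R, i N ≠ 0) :
    (pinsker i φ : Set M) ⊆ algebraicPart φ := by
  intro x hx
  by_contra hxW
  obtain ⟨N, hN⟩ := hne
  obtain ⟨y, hy⟩ := hi.exists_span_singleton_ne_zero N hN
  have hzero : entropyWith i φ (Submodule.span R {x}) = 0 :=
    pinsker_le_zeroEntropySubmodule hi φ hM hx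
  exact hy (le_antisymm
    ((le_entropyWith_of_notMem_algebraicPart hi hxW y).trans_eq hzero) zero_le)

end AlgFlow

theorem theorem5p15 {R : Type u} [Ring R] (i : ModuleCat.{v} R → ℝ≥0∞)
    (hi : AlgFlow.IsLengthFunction i)
    {M : Type v} [AddCommGroup M] [Module R M] (φ : Module.End R M)
    (hM : AlgFlow.LocallyFinite i M) :
    AlgFlow.integralPart φ ⊆ (AlgFlow.pinsker i φ : Set M) ∧
      (IsDomain R → (∃ N : ModuleCat.{v} R, i N ≠ 0) →
        (AlgFlow.pinsker i φ : Set M) ⊆ AlgFlow.algebraicPart φ) :=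
  ⟨AlgFlow.integralPart_subset_pinsker hi φ hM,
    fun _ hne => AlgFlow.pinsker_subset_algebraicPart hi φ hM hne⟩
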